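/- Let $n\ge 1$ be an integer. An $n$-th tropical meromorphic function is a continuous function $f:\mathbb R\to\mathbb R$ for which there are a strictly increasing sequence $(x_i)_{i\in\mathbb Z}$ with $x_i\to\pm\infty$ as $i\to\pm\infty$ and real polynomials $f_i$ with $f=f_i$ on $[x_{i-1},x_i]$ and $\sup_i\deg f_i=n$ (constant pieces count as degree $0$). It is called well defined if, for every $i$, the polynomial $f_i(x)-f_i(0)$ contains only odd powers or only even powers of $x$, and its coefficients are all non-negative or all non-positive. For $1\le j\le n$ and $x\in\mathbb R$ put $$\omega_f^{(j)}(x)=\frac{\operatorname{sgn}(x^+)^{j+1}f^{(j)}(x^+)-\operatorname{sgn}(x^-)^{j+1}f^{(j)}(x^-)}{j!},\qquad \operatorname{sgn}(0^\pm)=\pm1,$$ where $f^{(j)}(x^{\pm})$ are the one-sided $j$-th derivatives; $x$ is a $j$-th pole of $f$ if $\omega_f^{(j)}(x)<0$. Let $f^+=\max\{f,0\}$ and, for $r>0$, $$T(r,f)=\frac{f^+(r)+f^+(-r)}2+\sum_{j=1}^n\frac12\sum_{\substack{|z|<r\\ \omega_f^{(j)}(z)<0}}|\omega_f^{(j)}(z)|\,(r-|z|)^j,\qquad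 \rho_2(f)=\limsup_{r\to\infty}\frac{\log\log T(r,f)}{\log r}.$$ **Theorem.** Let $n\ge1$ be an integer, let $c$ be a non-zero real number, and let $f$ be a well defined $n$-th tropical meromorphic function with $\rho_2:=\rho_2(f)<1$. Let $\sigma\in(0,1-\rho_2)$. Then there is a measurable set $E\subset\mathbb R$ of finite logarithmic measure, $\int_{E\cap[1,\infty)}\frac{dr}{r}<\infty$, such that for $\delta=1$ and for $\delta=-1$ $$|f(\delta r+c)-f(\delta r)|=o\!\left(\frac{T(r,f)}{r^\sigma}\right)\qquad (r\to\infty,\ r\notin E).$$ -/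

import Mathlib

noncomputable section

namespace NTropical

open Polynomial

/-- `(x, p)` presents `f` as a continuous piecewise polynomial function: the breakpoints
`(x i)`, `i ∈ ℤ`, increase and have no finite accumulation point (so the segments cover the line),
`f` is the polynomial `p i` on the segment `[x (i-1), x i]`, and the supremum of the degrees
of the `p i` is `n`. -/
structure Presents (n : ℕ) (f : ℝ → ℝ) (x : ℤ → ℝ) (p : ℤ → ℝ[X]) : Prop where
  continuous : Continuous f
  strictMono : StrictMono x
  tendsto_top : Filter.Tendsto x Filter.atTop Filter.atTop
  tendsto_bot : Filter.Tendsto x Filter.atBot Filter.atBot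
  eq_eval : ∀ i : ℤ, ∀ t ∈ Set.Icc (x (i - 1)) (x i), f t = (p i).eval t
  sup_degree : IsLUB (Set.range fun i : ℤ => (p i).natDegree) n

/-- `n`-th tropical meromorphic functions on the real line (used for `1 ≤ n`). -/
def IsTropicalMeromorphic (n : ℕ) (f : ℝ → ℝ) : Prop :=
  ∃ (x : ℤ → ℝ) (p : ℤ → ℝ[X]), Presents n f x p

/-- A polynomial `p` is well defined if `p - p(0)` has only odd or only even powers,
with coefficients that are all non-negative or all non-positive. -/
def IsWellDefinedPoly (p : ℝ[X]) : Prop :=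
  ((∀ j : ℕ, j ≠ 0 → Even j → p.coeff j = 0) ∨ (∀ j : ℕ, j ≠ 0 → Odd j → p.coeff j = 0)) ∧
  ((∀ j : ℕ, j ≠ 0 → 0 ≤ p.coeff j) ∨ (∀ j : ℕ, j ≠ 0 → p.coeff j ≤ 0))

/-- Well defined `n`-th tropical meromorphic functions: well defined on each segment. -/
def IsWellDefined (n : ℕ) (f : ℝ → ℝ) : Prop :=
  ∃ (x : ℤ → ℝ) (p : ℤ → ℝ[X]), Presents n f x p ∧ ∀ i, IsWellDefinedPoly (p i)

/-- `f^(j)(x⁺)`. -/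
def rightDeriv (j : ℕ) (f : ℝ → ℝ) (x : ℝ) : ℝ := iteratedDerivWithin j f (Set.Ici x) x

/-- `f^(j)(x⁻)`. -/
def leftDeriv (j : ℕ) (f : ℝ → ℝ) (x : ℝ) : ℝ := iteratedDerivWithin j f (Set.Iic x) x

/-- `sgn(x⁺)`; in particular `sgn(0⁺) = 1`. -/
def sgnRight (x : ℝ) : ℝ := if 0 ≤ x then 1 else -1

/-- `sgn(x⁻)`; in particular `sgn(0⁻) = -1`. -/
def sgnLeft (x : ℝ) : ℝ := if 0 < x then 1 else -1

/-- `ω_f^(j)(x)`: the point `x` is a `j`-th root of `f` if this is positive and a `j`-th pole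
if it is negative, of multiplicity the absolute value. -/
def omega (j : ℕ) (f : ℝ → ℝ) (x : ℝ) : ℝ :=
  (sgnRight x ^ (j + 1) * rightDeriv j f x - sgnLeft x ^ (j + 1) * leftDeriv j f x) /
    (j.factorial : ℝ)

/-- The set of `j`-th poles of `f` in `(-r, r)`. -/
def polesIn (j : ℕ) (f : ℝ → ℝ) (r : ℝ) : Set ℝ := {z | z ∈ Set.Ioo (-r) r ∧ omega j f z < 0}

/-- The max-plus proximity function `m(r, f)`. -/
def proximity (f : ℝ → ℝ) (r : ℝ) : ℝ := (max (f r) 0 + max (f (-r)) 0) / 2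

/-- The `j`-th integrated max-plus counting function `N^(j)(r, f)`. The sum is finite for
the piecewise polynomial functions considered here and `1 ≤ j`. -/
def counting (j : ℕ) (f : ℝ → ℝ) (r : ℝ) : ℝ :=
  (1 / 2) * ∑ᶠ z ∈ polesIn j f r, |omega j f z| * (r - |z|) ^ j

/-- The `n`-th max-plus characteristic function `T(r, f)`. -/
def characteristic (n : ℕ) (f : ℝ → ℝ) (r : ℝ) : ℝ :=
  proximity f r + ∑ j ∈ Finset.Icc 1 n, counting j f r

/-- The hyper-order `ρ₂(f) = limsup log log T(r, f) / log r`, as an extended real number.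
For `f` an `n`-th tropical meromorphic function, `1 ≤ n`, `T(r, f)` tends to infinity, so that
the logarithms are those of positive numbers for large `r`. -/
def hyperOrder (n : ℕ) (f : ℝ → ℝ) : EReal :=
  Filter.limsup
    (fun r : ℝ => ((Real.log (Real.log (characteristic n f r)) / Real.log r : ℝ) : EReal))
    Filter.atTop

/-- `E` is a measurable set of radii with finite logarithmic measure
`∫_{E ∩ [1, ∞)} dr / r < ∞`. -/
def FiniteLogMeasure (E : Set ℝ) : Prop :=
  MeasurableSet E ∧ ∫⁻ r in E ∩ Set.Ici 1, ENNReal.ofReal (1 / r) < ⊤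

end NTropical

end

namespace NTropical

open Polynomial Filter Topology MeasureTheory


/-! On `[0, ∞)` a continuous piecewise polynomial is its polynomial at `0` plus truncated powers
`ω_j(z) (t - z)₊^j`, one for each jump in the derivatives (`Presents.eq_sum`). Adding this to the
same expansion of `t ↦ f (-t)` gives a Jensen formula: `f r + f (-r) - 2 f 0` is the signed sum of
all `ω_j(z) (r - |z|)₊^j`. So the sum `V(r)` of their absolute values is at most `4 T(r) - 2 f 0`
(`Presents.rootPoleSum_le`).

A truncated power has difference quotient at most `n (R - z)₊^j / (R - m)` up to `m < R`. Hence `|f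
(r + c) - f r|` is `O(W(R) / (R - r))`, where `W = V + r^n + 1` (`Presents.abs_sub_mul_le`). Since
`T` grows at least like `r^n`, `W = O(T)`.

Take `R = r + r^s` with `σ < s < 1 - ρ₂`. A Borel-type growth lemma gives `W(R) ≤ 2 W(r)` outside a
set of finite logarithmic measure, so the difference is `O(T / r^s) = o(T / r^σ)`. Reflection gives
`δ = -1` with the same exceptional set, as `W` is invariant under it. -/

/-! ### Growth of monotone functions outside a small exceptional set -/

theorem eventually_rpow_le_half {s : ℝ} (hs : s < 1) : ∀ᶠ r : ℝ in atTop, r ^ s ≤ r / 2 := by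
  filter_upwards [(tendsto_rpow_atTop (sub_pos.2 hs)).eventually_ge_atTop 2,
    eventually_gt_atTop (0 : ℝ)] with r h2 h0
  have h : r ^ (1 - s) * r ^ s = r := by
    rw [← Real.rpow_add h0]; simp
  nlinarith [Real.rpow_pos_of_pos h0 s]

theorem lintegral_Icc_one_div_le {b l : ℝ} (hb : 0 < b) (hl : l ≤ b / 2) :
    ∫⁻ r in Set.Icc (b - l) b, ENNReal.ofReal (1 / r) ≤ ENNReal.ofReal (2 / b * l) := by
  calc ∫⁻ r in Set.Icc (b - l) b, ENNReal.ofReal (1 / r)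
      ≤ ∫⁻ _ in Set.Icc (b - l) b, ENNReal.ofReal (2 / b) := by
        refine setLIntegral_mono' measurableSet_Icc fun r hr => ENNReal.ofReal_le_ofReal ?_
        have : b / 2 ≤ r := by linarith [hr.1]
        rw [div_le_div_iff₀ (by linarith) hb]
        linarith
    _ = ENNReal.ofReal (2 / b * l) := by
        rw [setLIntegral_const, Real.volume_Icc, ← ENNReal.ofReal_mul (by positivity)]
        congr 2
        ring

/-- A monotone function of hyper-order less than `1 - s` at most doubles between `r` and
`r + r ^ s`, outside a set of finite logarithmic measure. -/
theorem exists_finiteLogMeasure_le_two_mul {W : ℝ → ℝ} (hW : Monotone W) (h1 : ∀ r, 1 ≤ W r)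
    {μ s : ℝ} (hμ : 0 < μ) (hs : 0 < s) (hsμ : s + μ < 1)
    (hexp : ∀ᶠ r in atTop, W r ≤ Real.exp (r ^ μ)) :
    ∃ E, FiniteLogMeasure E ∧ ∀ᶠ r in atTop, r ∉ E → W (r + r ^ s) ≤ 2 * W r := by
  obtain ⟨R, hR⟩ := (hexp.and ((eventually_rpow_le_half (s := s) (by linarith)).and
    (eventually_ge_atTop (1 : ℝ)))).exists_forall_of_atTop
  -- `b k` is where `W` crosses level `2^(k+1)`. If `W` more than doubles on `[r, r + r^s]`, some `b
  -- k` lies there, so `r` is in `I k`, of logarithmic measure at most `2 (b k)^(s-1)`.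
  set b : ℕ → ℝ := fun k => sSup {r | W r < 2 ^ (k + 1)} with hb
  set K : Set ℕ := {k | BddAbove {r | W r < 2 ^ (k + 1)} ∧ R ≤ b k} with hK
  set I : ℕ → Set ℝ := fun k => Set.Icc (b k - b k ^ s) (b k) with hI
  -- The growth bound forces `b k` to be at least of order `k^(1/μ)`. It is applied at `2 * b k`,
  -- strictly beyond the supremum, because `W` may jump at `b k`.
  have hbK : ∀ k ∈ K, ((k : ℝ) + 1) * Real.log 2 ≤ (2 * b k) ^ μ := by
    intro k hk
    have hb1 : 1 ≤ b k := (hR _ hk.2).2.2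
    have hlt : ¬ W (2 * b k) < 2 ^ (k + 1) := fun h => by
      have := le_csSup hk.1 h
      change 2 * b k ≤ b k at this
      linarith
    have := (not_lt.1 hlt).trans (hR (2 * b k) (by linarith [hk.2])).1
    have h2 := Real.log_le_log (by positivity) this
    rw [Real.log_exp, Real.log_pow] at h2
    push_cast at h2
    exact h2
  set p : ℝ := (s - 1) / μ with hp
  -- This is where `s + μ < 1` makes the total logarithmic measure converge.
  have hp1 : p < -1 := by
    rw [hp, div_lt_iff₀ hμ]; linarith
  set C : ℝ := 2 * 2 ^ (1 - s) * (Real.log 2) ^ p with hC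
  have hterm : ∀ k ∈ K, 2 / b k * b k ^ s ≤ C * ((k : ℝ) + 1) ^ p := by
    intro k hk
    have hb1 : 1 ≤ b k := (hR _ hk.2).2.2
    have hl : 0 < Real.log 2 := Real.log_pos (by norm_num)
    have h3 : (2 * b k) ^ (s - 1) ≤ (((k : ℝ) + 1) * Real.log 2) ^ p := by
      have : (2 * b k) ^ (s - 1) = ((2 * b k) ^ μ) ^ p := by
        rw [← Real.rpow_mul (by positivity), hp, mul_div_cancel₀ _ hμ.ne']
      rw [this]
      exact Real.rpow_le_rpow_of_nonpos (by positivity) (hbK k hk) (by linarith)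
    rw [Real.mul_rpow (by positivity) hl.le, Real.mul_rpow (by norm_num) (by linarith)] at h3
    have h4 : 2 / b k * b k ^ s = 2 * b k ^ (s - 1) := by
      rw [Real.rpow_sub_one (by positivity)]; ring
    have h5 : (2 : ℝ) ^ (1 - s) * 2 ^ (s - 1) = 1 := by
      rw [← Real.rpow_add (by norm_num)]; simp
    calc 2 / b k * b k ^ s = 2 * 2 ^ (1 - s) * (2 ^ (s - 1) * b k ^ (s - 1)) := by
          rw [h4]; linear_combination (-2 * b k ^ (s - 1)) * h5
      _ ≤ 2 * 2 ^ (1 - s) * (((k : ℝ) + 1) ^ p * Real.log 2 ^ p) := by gcongr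
      _ = _ := by rw [hC]; ring
  have hsum : Summable fun k : ℕ => C * ((k : ℝ) + 1) ^ p := by
    refine Summable.mul_left _ ?_
    have := (summable_nat_add_iff 1).2 (Real.summable_nat_rpow.2 hp1)
    simpa using this
  refine ⟨⋃ k ∈ K, I k, ⟨?_, ?_⟩, ?_⟩
  · exact MeasurableSet.biUnion (Set.to_countable K) fun k _ => measurableSet_Icc
  · refine lt_of_le_of_lt ?_ (lt_top_iff_ne_top.2 hsum.tsum_ofReal_ne_top)
    calc ∫⁻ r in (⋃ k ∈ K, I k) ∩ Set.Ici 1, ENNReal.ofReal (1 / r)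
        ≤ ∫⁻ r in ⋃ k, ⋃ _ : k ∈ K, I k, ENNReal.ofReal (1 / r) :=
          lintegral_mono_set Set.inter_subset_left
      _ ≤ ∑' k, ∫⁻ r in ⋃ _ : k ∈ K, I k, ENNReal.ofReal (1 / r) := lintegral_iUnion_le _ _
      _ ≤ ∑' k : ℕ, ENNReal.ofReal (C * ((k : ℝ) + 1) ^ p) := by
          refine ENNReal.tsum_le_tsum fun k => ?_
          by_cases hk : k ∈ K
          · simp only [hk, Set.iUnion_true]
            have hb1 := (hR _ hk.2).2
            exact (lintegral_Icc_one_div_le (by linarith) hb1.1).trans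
              (ENNReal.ofReal_le_ofReal (hterm k hk))
          · simp [hk]
  · filter_upwards [eventually_ge_atTop R] with r hr hrE
    by_contra hlt
    push Not at hlt
    obtain ⟨k, hk1, hk2⟩ := exists_nat_pow_near (h1 r) (one_lt_two (α := ℝ))
    have hr0 : 0 ≤ r := by linarith [(hR r hr).2.2]
    have hub : r + r ^ s ∈ upperBounds {r | W r < 2 ^ (k + 1)} := by
      intro t ht
      by_contra h
      have := hW (not_le.1 h).le
      have ht' : W t < 2 ^ (k + 1) := ht
      rw [pow_succ] at ht'
      linarith
    have hle : r ≤ b k := le_csSup ⟨_, hub⟩ hk2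
    have hge : b k ≤ r + r ^ s := csSup_le ⟨r, hk2⟩ hub
    refine hrE (Set.mem_biUnion (x := k) ⟨⟨_, hub⟩, hr.trans hle⟩ ⟨?_, hle⟩)
    linarith [Real.rpow_le_rpow hr0 hle hs.le]

/-! ### One-sided derivatives as Taylor coefficients -/

theorem iteratedDeriv_polynomial_eval (p : ℝ[X]) (j : ℕ) :
    iteratedDeriv j (fun t => p.eval t) = fun t => (derivative^[j] p).eval t := by
  induction j with
  | zero => simp
  | succ j ih =>
    rw [iteratedDeriv_succ, ih]
    ext t
    rw [Polynomial.deriv, Function.iterate_succ_apply']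

theorem iterate_derivative_eval (p : ℝ[X]) (j : ℕ) (z : ℝ) :
    (derivative^[j] p).eval z = j.factorial * (taylor z p).coeff j := by
  rw [taylor_coeff, ← factorial_smul_hasseDeriv]
  simp

theorem contDiff_eval (p : ℝ[X]) {k : WithTop ℕ∞} : ContDiff ℝ k fun t => p.eval t := by
  simpa [coe_aeval_eq_eval] using p.contDiff_aeval (𝕜 := ℝ) k

theorem rightDeriv_eq {f : ℝ → ℝ} {p : ℝ[X]} {z : ℝ}
    (h : f =ᶠ[𝓝[Set.Ici z] z] fun t => p.eval t) (j : ℕ) :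
    rightDeriv j f z = j.factorial * (taylor z p).coeff j := by
  rw [rightDeriv, h.iteratedDerivWithin_eq (h.eq_of_nhdsWithin Set.self_mem_Ici),
    iteratedDerivWithin_eq_iteratedDeriv (uniqueDiffOn_Ici z) (contDiff_eval p).contDiffAt
      Set.self_mem_Ici, iteratedDeriv_polynomial_eval]
  exact iterate_derivative_eval p j z

theorem leftDeriv_eq {f : ℝ → ℝ} {p : ℝ[X]} {z : ℝ}
    (h : f =ᶠ[𝓝[Set.Iic z] z] fun t => p.eval t) (j : ℕ) :
    leftDeriv j f z = j.factorial * (taylor z p).coeff j := by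
  rw [leftDeriv, h.iteratedDerivWithin_eq (h.eq_of_nhdsWithin Set.self_mem_Iic),
    iteratedDerivWithin_eq_iteratedDeriv (uniqueDiffOn_Iic z) (contDiff_eval p).contDiffAt
      Set.self_mem_Iic, iteratedDeriv_polynomial_eval]
  exact iterate_derivative_eval p j z

theorem omega_of_pos {f : ℝ → ℝ} {p q : ℝ[X]} {z : ℝ} (hz : 0 < z)
    (hl : f =ᶠ[𝓝[Set.Iic z] z] fun t => p.eval t) (hr : f =ᶠ[𝓝[Set.Ici z] z] fun t => q.eval t)
    (j : ℕ) : omega j f z = (taylor z (q - p)).coeff j := by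
  have : (j.factorial : ℝ) ≠ 0 := by positivity
  rw [omega, rightDeriv_eq hr, leftDeriv_eq hl, sgnRight, sgnLeft, if_pos hz.le, if_pos hz]
  simp only [one_pow, one_mul, map_sub, coeff_sub]
  field_simp

theorem sum_range_succ_eq_add_sum_Icc (F : ℕ → ℝ) (n : ℕ) :
    ∑ j ∈ Finset.range (n + 1), F j = F 0 + ∑ j ∈ Finset.Icc 1 n, F j := by
  rw [Finset.range_eq_Ico, Finset.sum_eq_sum_Ico_succ_bot (Nat.succ_pos n)]
  rfl

theorem eval_eq_taylor_sum {q : ℝ[X]} {n : ℕ} (hq : q.natDegree ≤ n) (z t : ℝ) :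
    q.eval t = q.eval z + ∑ j ∈ Finset.Icc 1 n, (taylor z q).coeff j * (t - z) ^ j := by
  have h : q.eval t = (taylor z q).eval (t - z) := by rw [taylor_eval]; simp
  rw [h, eval_eq_sum_range' (n := n + 1) (by rw [natDegree_taylor]; omega),
    sum_range_succ_eq_add_sum_Icc]
  simp

/-! ### Expansion in truncated powers on the half line -/

namespace Presents

variable {n : ℕ} {f : ℝ → ℝ} {x : ℤ → ℝ} {p : ℤ → ℝ[X]}

theorem natDegree_le (h : Presents n f x p) (i : ℤ) : (p i).natDegree ≤ n :=
  h.sup_degree.1 ⟨i, rfl⟩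

theorem exists_coeff_ne_zero (h : Presents n f x p) (hn : 1 ≤ n) : ∃ i, (p i).coeff n ≠ 0 := by
  by_contra! hc
  have : n ≤ n - 1 := h.sup_degree.2 (by
    rintro _ ⟨i, rfl⟩
    have h1 := h.natDegree_le i
    rcases h1.lt_or_eq with h2 | h2
    · change (p i).natDegree ≤ n - 1; omega
    · exfalso
      have h3 := hc i
      rw [← h2] at h3
      have h4 : (p i).leadingCoeff = 0 := h3
      rw [leadingCoeff_eq_zero] at h4
      rw [h4] at h2
      simp at h2
      omega)
  omega

theorem exists_mem_segment (h : Presents n f x p) (t : ℝ) : ∃ i, x (i - 1) ≤ t ∧ t < x i := by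
  obtain ⟨a, ha⟩ := (h.tendsto_bot.eventually_le_atBot t).exists
  obtain ⟨b, hb⟩ := (h.tendsto_top.eventually_gt_atTop t).exists
  obtain ⟨i, hi, hmax⟩ := Int.exists_greatest_of_bdd (P := fun i => x i ≤ t)
    ⟨b, fun z hz => by
      by_contra hc
      exact absurd (hz.trans_lt hb) (h.strictMono (not_le.1 hc)).not_gt⟩ ⟨a, ha⟩
  refine ⟨i + 1, by simpa using hi, ?_⟩
  by_contra hc
  have := hmax _ (not_lt.1 hc)
  omega

theorem eventuallyEq_right (h : Presents n f x p) {i : ℤ} {t : ℝ} (h1 : x (i - 1) ≤ t)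
    (h2 : t < x i) : f =ᶠ[𝓝[Set.Ici t] t] fun s => (p i).eval s := by
  filter_upwards [Ico_mem_nhdsGE h2] with s hs
  exact h.eq_eval i s ⟨h1.trans hs.1, hs.2.le⟩

theorem eventuallyEq_left (h : Presents n f x p) {i : ℤ} {t : ℝ} (h1 : x (i - 1) < t)
    (h2 : t ≤ x i) : f =ᶠ[𝓝[Set.Iic t] t] fun s => (p i).eval s := by
  filter_upwards [Ioc_mem_nhdsLE h1] with s hs
  exact h.eq_eval i s ⟨hs.1.le, hs.2.trans h2⟩

theorem omega_breakpoint (h : Presents n f x p) {i : ℤ} (hi : 0 < x i) (j : ℕ) :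
    omega j f (x i) = (taylor (x i) (p (i + 1) - p i)).coeff j :=
  omega_of_pos hi (h.eventuallyEq_left (h.strictMono (by omega)) le_rfl)
    (h.eventuallyEq_right (by simp) (h.strictMono (by omega))) j

theorem exists_breakpoint (h : Presents n f x p) {z : ℝ} (hz : 0 < z) {j : ℕ}
    (hj : omega j f z ≠ 0) : ∃ i, x i = z := by
  obtain ⟨i, h1, h2⟩ := h.exists_mem_segment z
  rcases h1.lt_or_eq with h1 | h1
  · exact absurd (by
      rw [omega_of_pos hz (h.eventuallyEq_left h1 h2.le) (h.eventuallyEq_right h1.le h2)]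
      simp) hj
  · exact ⟨_, h1⟩

theorem eval_breakpoint (h : Presents n f x p) (i : ℤ) :
    (p (i + 1)).eval (x i) = (p i).eval (x i) := by
  rw [← h.eq_eval i _ ⟨(h.strictMono (by omega)).le, le_rfl⟩,
    ← h.eq_eval (i + 1) _ ⟨by simp, (h.strictMono (by omega)).le⟩]

/-- By continuity, neighbouring polynomials agree at the breakpoint, so the Taylor expansion of
their difference there has no constant term; its other coefficients are the `ω`. -/
theorem eval_succ (h : Presents n f x p) {i : ℤ} (hi : 0 < x i) (t : ℝ) :
    (p (i + 1)).eval t =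
      (p i).eval t + ∑ j ∈ Finset.Icc 1 n, omega j f (x i) * (t - x i) ^ j := by
  have hd : (p (i + 1) - p i).natDegree ≤ n :=
    (natDegree_sub_le _ _).trans (max_le (h.natDegree_le _) (h.natDegree_le _))
  have := eval_eq_taylor_sum hd (x i) t
  simp only [eval_sub, h.eval_breakpoint, sub_self, zero_add] at this
  simp only [h.omega_breakpoint hi]
  linarith

theorem eval_telescope (h : Presents n f x p) {i : ℤ} (hi : 0 < x i) (m : ℕ) (t : ℝ) :
    (p (i + m)).eval t = (p i).eval t + ∑ k ∈ Finset.range m,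
      ∑ j ∈ Finset.Icc 1 n, omega j f (x (i + k)) * (t - x (i + k)) ^ j := by
  induction m with
  | zero => simp
  | succ m ih =>
    have : 0 < x (i + m) := hi.trans_le (h.strictMono.monotone (by omega))
    rw [Finset.sum_range_succ, ← add_assoc, ← ih, ← h.eval_succ this]
    push_cast
    rw [add_assoc]

theorem eq_sum_range (h : Presents n f x p) {i : ℤ} (h0 : x (i - 1) ≤ 0) (hi : 0 < x i) (m : ℕ)
    {t : ℝ} (ht : 0 ≤ t) (htm : t ≤ x (i + m)) :
    f t = (p i).eval t + ∑ k ∈ Finset.range m,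
      ∑ j ∈ Finset.Icc 1 n, omega j f (x (i + k)) * (max (t - x (i + k)) 0) ^ j := by
  induction m with
  | zero => simpa using h.eq_eval i t ⟨h0.trans ht, by simpa using htm⟩
  | succ m ih =>
    rcases le_total t (x (i + m)) with h1 | h1
    · rw [ih h1, Finset.sum_range_succ, max_eq_right (sub_nonpos.2 h1), add_right_inj, left_eq_add]
      refine Finset.sum_eq_zero fun j hj => ?_
      rw [zero_pow (by have := Finset.mem_Icc.1 hj; omega), mul_zero]
    · rw [h.eq_eval (i + (m + 1 : ℕ)) t ⟨by
        rwa [show i + ((m + 1 : ℕ) : ℤ) - 1 = i + m by push_cast; ring], htm⟩,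
        h.eval_telescope hi]
      congr 1
      refine Finset.sum_congr rfl fun k hk => ?_
      have : x (i + k) ≤ x (i + m) :=
        h.strictMono.monotone (by have := Finset.mem_range.1 hk; omega)
      rw [max_eq_left (by linarith)]

theorem eval_initial (h : Presents n f x p) {i : ℤ} (h0 : x (i - 1) ≤ 0) (hi : 0 < x i) (t : ℝ) :
    (p i).eval t =
      f 0 + ∑ j ∈ Finset.Icc 1 n, rightDeriv j f 0 / j.factorial * t ^ j := by
  rw [eval_eq_taylor_sum (h.natDegree_le i) 0, h.eq_eval i 0 ⟨h0, hi.le⟩]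
  congr 1
  refine Finset.sum_congr rfl fun j _ => ?_
  have : (j.factorial : ℝ) ≠ 0 := by positivity
  rw [rightDeriv_eq (h.eventuallyEq_right h0 hi), mul_div_cancel_left₀ _ this, sub_zero]

/-- Translation does not change the coefficient of degree `n`, so `omega n` at a positive breakpoint
is exactly its jump. With no jumps, its value next to the origin propagates to the right. -/
theorem coeff_eq_zero_of_pos (h : Presents n f x p) (hω : ∀ z, 0 < z → omega n f z = 0)
    (h0 : rightDeriv n f 0 = 0) {i : ℤ} (hi : 0 < x i) : (p i).coeff n = 0 := by
  have key : ∀ (q : ℝ[X]), q.natDegree ≤ n → ∀ z, (taylor z q).coeff n = q.coeff n := by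
    intro q hq z
    rcases hq.lt_or_eq with hq | hq
    · rw [coeff_eq_zero_of_natDegree_lt hq,
        coeff_eq_zero_of_natDegree_lt (by rwa [natDegree_taylor])]
    · have := leadingCoeff_taylor z q
      rw [leadingCoeff, leadingCoeff, natDegree_taylor, hq] at this
      exact this
  obtain ⟨a, ha0, ha⟩ := h.exists_mem_segment 0
  have hai : a ≤ i := by
    by_contra hc
    have := h.strictMono.monotone (show i ≤ a - 1 by omega)
    linarith
  induction i, hai using Int.leInduction with
  | base =>
    rw [rightDeriv_eq (h.eventuallyEq_right ha0 ha), key _ (h.natDegree_le a)] at h0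
    exact (mul_eq_zero.1 h0).resolve_left (by positivity)
  | succ i hai ih =>
    have hi' : 0 < x i := ha.trans_le (h.strictMono.monotone hai)
    have h1 := hω _ hi'
    rw [h.omega_breakpoint hi', key _ ((natDegree_sub_le _ _).trans
      (max_le (h.natDegree_le _) (h.natDegree_le _))), coeff_sub, ih hi'] at h1
    simpa using h1

theorem exists_finset (h : Presents n f x p) (r : ℝ) : ∃ Z : Finset ℝ, (∀ z ∈ Z, 0 < z) ∧
    (∀ j z, 0 < z → z < r → omega j f z ≠ 0 → z ∈ Z) ∧
    ∀ t, 0 ≤ t → t ≤ r → f t = f 0 + ∑ j ∈ Finset.Icc 1 n, rightDeriv j f 0 / j.factorial * t ^ j +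
      ∑ z ∈ Z, ∑ j ∈ Finset.Icc 1 n, omega j f z * (max (t - z) 0) ^ j := by
  obtain ⟨i, h0, hi⟩ := h.exists_mem_segment 0
  obtain ⟨b, hb⟩ := (h.tendsto_top.eventually_ge_atTop r).exists
  obtain ⟨m, hm⟩ : ∃ m : ℕ, b ≤ i + m := ⟨(b - i).toNat, by omega⟩
  have hrm : r ≤ x (i + m) := hb.trans (h.strictMono.monotone hm)
  refine ⟨(Finset.range m).image fun k : ℕ => x (i + k), ?_, ?_, ?_⟩
  · simp only [Finset.mem_image]
    rintro _ ⟨k, _, rfl⟩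
    exact hi.trans_le (h.strictMono.monotone (by omega))
  · intro j z hz hzr hne
    obtain ⟨a, rfl⟩ := h.exists_breakpoint hz hne
    have h1 : i - 1 < a := h.strictMono.lt_iff_lt.1 (h0.trans_lt hz)
    have h2 : a < i + m := h.strictMono.lt_iff_lt.1 (hzr.trans_le hrm)
    refine Finset.mem_image.2 ⟨(a - i).toNat, by rw [Finset.mem_range]; omega, ?_⟩
    congr 1
    omega
  · intro t ht htr
    rw [h.eq_sum_range h0 hi m ht (htr.trans hrm), h.eval_initial h0 hi, Finset.sum_image]
    intro k _ l _ hkl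
    have := h.strictMono.injective hkl
    omega

/-- Taylor expansion with jumps on the half line. -/
theorem eq_sum (h : Presents n f x p) {t : ℝ} (ht : 0 ≤ t) {Z : Finset ℝ} (hpos : ∀ z ∈ Z, 0 < z)
    (hZ : ∀ j ∈ Finset.Icc 1 n, ∀ z, 0 < z → z < t → omega j f z ≠ 0 → z ∈ Z) :
    f t = f 0 + ∑ j ∈ Finset.Icc 1 n, rightDeriv j f 0 / j.factorial * t ^ j +
      ∑ z ∈ Z, ∑ j ∈ Finset.Icc 1 n, omega j f z * (max (t - z) 0) ^ j := by
  classical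
  obtain ⟨Y, hYpos, hY, hrep⟩ := h.exists_finset t
  rw [hrep t ht le_rfl]
  congr 1
  -- Any two sets containing the jumps before `t` give the same sum: compare each with the union.
  have aux : ∀ A B : Finset ℝ, (∀ z ∈ B, 0 < z) →
      (∀ j ∈ Finset.Icc 1 n, ∀ z, 0 < z → z < t → omega j f z ≠ 0 → z ∈ A) →
      ∑ z ∈ A, ∑ j ∈ Finset.Icc 1 n, omega j f z * (max (t - z) 0) ^ j =
      ∑ z ∈ A ∪ B, ∑ j ∈ Finset.Icc 1 n, omega j f z * (max (t - z) 0) ^ j := by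
    intro A B hB hA
    refine Finset.sum_subset Finset.subset_union_left fun z hz hzA => ?_
    have hz0 := hB z ((Finset.mem_union.1 hz).resolve_left hzA)
    refine Finset.sum_eq_zero fun j hj => ?_
    rcases lt_or_ge z t with hzt | hzt
    · rw [not_not.1 (mt (hA j hj z hz0 hzt) hzA), zero_mul]
    · rw [max_eq_right (by linarith), zero_pow (by have := Finset.mem_Icc.1 hj; omega), mul_zero]
  rw [aux Y Z hpos fun j _ => hY j, aux Z Y hYpos hZ, Finset.union_comm]

/-- The presentation of `t ↦ f (-t)`. -/
theorem comp_neg (h : Presents n f x p) :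
    Presents n (fun t => f (-t)) (fun i => -x (-i)) (fun i => (p (1 - i)).comp (-X)) where
  continuous := h.continuous.comp continuous_neg
  strictMono := fun a b hab => neg_lt_neg (h.strictMono (neg_lt_neg hab))
  tendsto_top := tendsto_neg_atBot_atTop.comp (h.tendsto_bot.comp tendsto_neg_atTop_atBot)
  tendsto_bot := tendsto_neg_atTop_atBot.comp (h.tendsto_top.comp tendsto_neg_atBot_atTop)
  eq_eval := by
    intro i t ht
    -- The reflected segment `[-x (1 - i), -x (-i)]` comes from `[x (-i), x (1 - i)]`, hence the
    -- index `1 - i`.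
    have := h.eq_eval (1 - i) (-t) ⟨by
      rw [show 1 - i - 1 = -i by ring]; linarith [ht.2], by
      have := ht.1
      rw [neg_sub] at this
      linarith⟩
    simpa using this
  sup_degree := by
    have : (Set.range fun i : ℤ => ((p (1 - i)).comp (-X)).natDegree) =
        Set.range fun i : ℤ => (p i).natDegree := by
      rw [← (Equiv.subLeft (1 : ℤ)).surjective.range_comp]
      congr 1
      ext i
      simp [natDegree_comp]
    rw [this]
    exact h.sup_degree

end Presents

/-! ### Reflection, and the behaviour at the origin -/

theorem rightDeriv_comp_neg (f : ℝ → ℝ) (j : ℕ) (z : ℝ) :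
    rightDeriv j (fun t => f (-t)) z = (-1) ^ j * leftDeriv j f (-z) := by
  rw [rightDeriv, leftDeriv, iteratedDerivWithin_comp_neg]
  simp

theorem leftDeriv_comp_neg (f : ℝ → ℝ) (j : ℕ) (z : ℝ) :
    leftDeriv j (fun t => f (-t)) z = (-1) ^ j * rightDeriv j f (-z) := by
  rw [rightDeriv, leftDeriv, iteratedDerivWithin_comp_neg]
  simp

/-- Reflection swaps the two sides and gives a factor `(-1)^j` from the derivative and `(-1)^(j+1)`
from the signs; these cancel. -/
theorem omega_comp_neg (f : ℝ → ℝ) (j : ℕ) (z : ℝ) :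
    omega j (fun t => f (-t)) z = omega j f (-z) := by
  have h1 : sgnRight z = -sgnLeft (-z) := by
    unfold sgnRight sgnLeft; split_ifs <;> linarith
  have h2 : sgnLeft z = -sgnRight (-z) := by
    unfold sgnRight sgnLeft; split_ifs <;> linarith
  rw [omega, omega, rightDeriv_comp_neg, leftDeriv_comp_neg, h1, h2, neg_pow (sgnLeft _),
    neg_pow (sgnRight _)]
  have : (-1 : ℝ) ^ (j + 1) * (-1) ^ j = -1 := by
    rw [← pow_add]; exact Odd.neg_one_pow ⟨j, by ring⟩
  congr 1
  linear_combination (sgnLeft (-z) ^ (j + 1) * leftDeriv j f (-z) -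
    sgnRight (-z) ^ (j + 1) * rightDeriv j f (-z)) * this

/-- The signs at `0` turn the jump into a sum, so the origin's term in the Jensen formula absorbs
the initial polynomials of both half lines. -/
theorem omega_zero (f : ℝ → ℝ) (j : ℕ) :
    omega j f 0 = rightDeriv j f 0 / j.factorial +
      rightDeriv j (fun t => f (-t)) 0 / j.factorial := by
  rw [rightDeriv_comp_neg, omega, sgnRight, sgnLeft, if_pos le_rfl, if_neg (lt_irrefl _), neg_zero]
  ring

/-- Twice the sum of the counting functions of the roots and of the poles. -/
noncomputable def rootPoleSum (n : ℕ) (f : ℝ → ℝ) (r : ℝ) : ℝ :=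
  ∑ j ∈ Finset.Icc 1 n, ∑ᶠ z, |omega j f z| * (max (r - |z|) 0) ^ j

/-- A monotone function comparable with the characteristic. -/
noncomputable def majorant (n : ℕ) (f : ℝ → ℝ) (r : ℝ) : ℝ := rootPoleSum n f r + max r 0 ^ n + 1

/-- `Z` contains all roots and poles in `(-r, r)`, and the origin. -/
structure Covers (n : ℕ) (f : ℝ → ℝ) (r : ℝ) (Z : Finset ℝ) : Prop where
  zero_mem : 0 ∈ Z
  mem : ∀ j ∈ Finset.Icc 1 n, ∀ z, |z| < r → omega j f z ≠ 0 → z ∈ Z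

variable {n : ℕ} {f : ℝ → ℝ} {x : ℤ → ℝ} {p : ℤ → ℝ[X]} {r : ℝ} {Z : Finset ℝ}

/-! ### Counting functions as finite sums -/

theorem pow_eq_zero_of_le_abs {j : ℕ} (hj : j ∈ Finset.Icc 1 n) {z : ℝ} (h : r ≤ |z|) :
    (max (r - |z|) 0) ^ j = 0 := by
  rw [max_eq_right (by linarith), zero_pow (by have := Finset.mem_Icc.1 hj; omega)]

namespace Covers

theorem mono (hZ : Covers n f r Z) {s : ℝ} (hs : s ≤ r) : Covers n f s Z :=
  ⟨hZ.zero_mem, fun j hj z hz => hZ.mem j hj z (hz.trans_le hs)⟩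

theorem comp_neg (hZ : Covers n f r Z) : Covers n (fun t => f (-t)) r (Z.image Neg.neg) := by
  refine ⟨Finset.mem_image.2 ⟨0, hZ.zero_mem, neg_zero⟩, fun j hj z hz hne => ?_⟩
  rw [omega_comp_neg] at hne
  exact Finset.mem_image.2 ⟨-z, hZ.mem j hj (-z) (by rwa [abs_neg]) hne, neg_neg z⟩

theorem finsum_eq (hZ : Covers n f r Z) {j : ℕ} (hj : j ∈ Finset.Icc 1 n) :
    ∑ᶠ z, |omega j f z| * (max (r - |z|) 0) ^ j =
      ∑ z ∈ Z, |omega j f z| * (max (r - |z|) 0) ^ j := by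
  refine finsum_eq_sum_of_support_subset _ fun z hz => ?_
  rcases lt_or_ge |z| r with h | h
  · exact hZ.mem j hj z h fun h0 => hz (by simp [h0])
  · exact absurd (by simp only [pow_eq_zero_of_le_abs hj h, mul_zero]) hz

theorem rootPoleSum_eq (hZ : Covers n f r Z) :
    rootPoleSum n f r =
      ∑ j ∈ Finset.Icc 1 n, ∑ z ∈ Z, |omega j f z| * (max (r - |z|) 0) ^ j :=
  Finset.sum_congr rfl fun _ hj => hZ.finsum_eq hj

theorem counting_eq (hZ : Covers n f r Z) {j : ℕ} (hj : j ∈ Finset.Icc 1 n) :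
    counting j f r = 1 / 2 * ∑ z ∈ Z, max (-omega j f z) 0 * (max (r - |z|) 0) ^ j := by
  classical
  rw [counting]
  congr 1
  have : polesIn j f r = ((Z.filter fun z => z ∈ polesIn j f r : Finset ℝ) : Set ℝ) := by
    ext z
    simp only [Finset.coe_filter, Set.mem_ofPred_eq, iff_and_self]
    exact fun hz => hZ.mem j hj z (abs_lt.2 hz.1) hz.2.ne
  rw [this, finsum_mem_coe_finset, Finset.sum_filter]
  refine Finset.sum_congr rfl fun z _ => ?_
  split_ifs with h
  · have h1 := abs_lt.2 h.1
    rw [abs_of_neg h.2, max_eq_left (by linarith [h.2]), max_eq_left (by linarith)]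
  · by_cases h2 : omega j f z < 0
    · have h3 : r ≤ |z| := not_lt.1 fun h3 => h ⟨abs_lt.1 h3, h2⟩
      rw [pow_eq_zero_of_le_abs hj h3, mul_zero]
    · rw [max_eq_right (by linarith), zero_mul]

end Covers

theorem counting_nonneg (j : ℕ) (f : ℝ → ℝ) (r : ℝ) : 0 ≤ counting j f r := by
  refine mul_nonneg (by norm_num) (finsum_nonneg fun z => finsum_nonneg fun hz => ?_)
  have := abs_lt.2 hz.1
  exact mul_nonneg (abs_nonneg _) (pow_nonneg (by linarith) _)

theorem le_two_mul_characteristic (n : ℕ) (f : ℝ → ℝ) (r : ℝ) :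
    f r ≤ 2 * characteristic n f r ∧ f (-r) ≤ 2 * characteristic n f r := by
  have h := Finset.sum_nonneg fun j (_ : j ∈ Finset.Icc 1 n) => counting_nonneg j f r
  rw [characteristic, proximity]
  constructor <;> linarith [le_max_left (f r) 0, le_max_left (f (-r)) 0, le_max_right (f r) 0,
    le_max_right (f (-r)) 0]

theorem rootPoleSum_comp_neg (n : ℕ) (f : ℝ → ℝ) (r : ℝ) :
    rootPoleSum n (fun t => f (-t)) r = rootPoleSum n f r := by
  refine Finset.sum_congr rfl fun j _ => ?_
  rw [← finsum_comp_equiv (Equiv.neg ℝ)]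
  simp [omega_comp_neg]

theorem majorant_comp_neg (n : ℕ) (f : ℝ → ℝ) (r : ℝ) :
    majorant n (fun t => f (-t)) r = majorant n f r := by
  rw [majorant, majorant, rootPoleSum_comp_neg]

theorem rootPoleSum_nonneg (n : ℕ) (f : ℝ → ℝ) (r : ℝ) : 0 ≤ rootPoleSum n f r :=
  Finset.sum_nonneg fun _ _ => finsum_nonneg fun _ =>
    mul_nonneg (abs_nonneg _) (pow_nonneg (le_max_right _ _) _)

theorem one_le_majorant (n : ℕ) (f : ℝ → ℝ) (r : ℝ) : 1 ≤ majorant n f r := by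
  have h1 := rootPoleSum_nonneg n f r
  have h2 : 0 ≤ max r 0 ^ n := pow_nonneg (le_max_right _ _) _
  rw [majorant]
  linarith

/-! ### The Jensen formula and bounds by the root and pole sum -/

namespace Presents

theorem exists_covers (h : Presents n f x p) (r : ℝ) : ∃ Z, Covers n f r Z := by
  classical
  obtain ⟨A, -, hA, -⟩ := h.exists_finset r
  obtain ⟨B, -, hB, -⟩ := h.comp_neg.exists_finset r
  refine ⟨insert 0 (A ∪ B.image Neg.neg), by simp, fun j _ z hz hne => ?_⟩
  rcases lt_trichotomy z 0 with h0 | rfl | h0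
  · have := hB j (-z) (by linarith) (by rwa [abs_of_neg h0] at hz)
      (by rwa [omega_comp_neg, neg_neg])
    refine Finset.mem_insert_of_mem (Finset.mem_union_right _ ?_)
    exact Finset.mem_image.2 ⟨-z, this, neg_neg z⟩
  · exact Finset.mem_insert_self _ _
  · refine Finset.mem_insert_of_mem (Finset.mem_union_left _ ?_)
    exact hA j z h0 (by rwa [abs_of_pos h0] at hz) hne

theorem rootPoleSum_mono (h : Presents n f x p) : Monotone (rootPoleSum n f) := by
  intro r s hrs
  obtain ⟨Z, hZ⟩ := h.exists_covers s
  rw [hZ.rootPoleSum_eq, (hZ.mono hrs).rootPoleSum_eq]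
  gcongr with j _ z _

theorem majorant_mono (h : Presents n f x p) : Monotone (majorant n f) := by
  intro r s hrs
  have h1 := h.rootPoleSum_mono hrs
  have h2 : max r 0 ^ n ≤ max s 0 ^ n := by gcongr
  rw [majorant, majorant]
  linarith

theorem eq_sum_of_covers (h : Presents n f x p) {t : ℝ} (ht : 0 ≤ t) (htr : t ≤ r)
    (hZ : Covers n f r Z) :
    f t = f 0 + ∑ j ∈ Finset.Icc 1 n, rightDeriv j f 0 / j.factorial * t ^ j +
      ∑ z ∈ Z.filter (0 < ·), ∑ j ∈ Finset.Icc 1 n, omega j f z * (max (t - z) 0) ^ j := by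
  refine h.eq_sum ht (fun z hz => (Finset.mem_filter.1 hz).2) fun j hj z hz hzt hne => ?_
  exact Finset.mem_filter.2 ⟨hZ.mem j hj z (by rw [abs_of_pos hz]; linarith) hne, hz⟩

/-- The tropical Jensen formula. -/
theorem jensen (h : Presents n f x p) (hr : 0 ≤ r) (hZ : Covers n f r Z) :
    f r + f (-r) = 2 * f 0 +
      ∑ j ∈ Finset.Icc 1 n, ∑ z ∈ Z, omega j f z * (max (r - |z|) 0) ^ j := by
  have h1 := h.eq_sum_of_covers hr le_rfl hZ
  have h2 := h.comp_neg.eq_sum_of_covers hr le_rfl hZ.comp_neg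
  simp only [neg_zero] at h2
  have h3 : ∑ z ∈ (Z.image Neg.neg).filter (0 < ·), ∑ j ∈ Finset.Icc 1 n,
      omega j (fun t => f (-t)) z * (max (r - z) 0) ^ j =
      ∑ z ∈ Z.filter (· < 0), ∑ j ∈ Finset.Icc 1 n, omega j f z * (max (r - |z|) 0) ^ j := by
    rw [Finset.filter_image, Finset.sum_image fun a _ b _ hab => neg_injective hab]
    simp only [Left.neg_pos_iff]
    refine Finset.sum_congr rfl fun z hz => Finset.sum_congr rfl fun j _ => ?_
    rw [omega_comp_neg, neg_neg, abs_of_neg (Finset.mem_filter.1 hz).2]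
  have h4 : ∑ z ∈ Z.filter (0 < ·), ∑ j ∈ Finset.Icc 1 n, omega j f z * (max (r - z) 0) ^ j =
      ∑ z ∈ Z.filter (0 < ·), ∑ j ∈ Finset.Icc 1 n, omega j f z * (max (r - |z|) 0) ^ j := by
    refine Finset.sum_congr rfl fun z hz => ?_
    rw [abs_of_pos (Finset.mem_filter.1 hz).2]
  have h5 : ∑ j ∈ Finset.Icc 1 n, omega j f 0 * (max (r - |0|) 0) ^ j =
      ∑ j ∈ Finset.Icc 1 n, rightDeriv j f 0 / j.factorial * r ^ j +
      ∑ j ∈ Finset.Icc 1 n, rightDeriv j (fun t => f (-t)) 0 / j.factorial * r ^ j := by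
    rw [← Finset.sum_add_distrib]
    refine Finset.sum_congr rfl fun j _ => ?_
    rw [omega_zero, abs_zero, sub_zero, max_eq_left hr]
    ring
  have h6 : ∀ G : ℝ → ℝ, ∑ z ∈ Z, G z =
      G 0 + ∑ z ∈ Z.filter (0 < ·), G z + ∑ z ∈ Z.filter (· < 0), G z := by
    intro G
    rw [← Finset.sum_filter_add_sum_filter_not Z (fun z => 0 < z),
      ← Finset.sum_filter_add_sum_filter_not (Z.filter fun z => ¬ 0 < z) (fun z => z < 0),
      Finset.filter_filter, Finset.filter_filter]
    have e1 : Z.filter (fun z => ¬ 0 < z ∧ z < 0) = Z.filter (· < 0) := by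
      ext z
      simp only [Finset.mem_filter, and_congr_right_iff, and_iff_right_iff_imp]
      exact fun _ hz => hz.le.not_gt
    have e2 : Z.filter (fun z => ¬ 0 < z ∧ ¬ z < 0) = {0} := by
      ext z
      simp only [Finset.mem_filter, Finset.mem_singleton, not_lt]
      exact ⟨fun hz => le_antisymm hz.2.1 hz.2.2, by rintro rfl; exact ⟨hZ.zero_mem, le_rfl, le_rfl⟩⟩
    rw [e1, e2, Finset.sum_singleton]
    ring
  rw [Finset.sum_comm, h6, h5, ← h4, ← h3, h1, h2]
  ring

/-- Write `|ω| = ω + 2 ω⁻`. Jensen evaluates the signed part as `f r + f (-r) - 2 f 0`, and the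
negative part contributes four times the counting functions. -/
theorem rootPoleSum_le (h : Presents n f x p) (hr : 0 ≤ r) :
    rootPoleSum n f r ≤ 4 * characteristic n f r - 2 * f 0 := by
  obtain ⟨Z, hZ⟩ := h.exists_covers r
  have hJ := h.jensen hr hZ
  have hc : ∑ j ∈ Finset.Icc 1 n, counting j f r =
      1 / 2 * ∑ j ∈ Finset.Icc 1 n, ∑ z ∈ Z, max (-omega j f z) 0 * (max (r - |z|) 0) ^ j := by
    rw [Finset.mul_sum]
    exact Finset.sum_congr rfl fun j hj => hZ.counting_eq hj
  have hV : rootPoleSum n f r =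
      ∑ j ∈ Finset.Icc 1 n, ∑ z ∈ Z, omega j f z * (max (r - |z|) 0) ^ j +
      2 * ∑ j ∈ Finset.Icc 1 n, ∑ z ∈ Z, max (-omega j f z) 0 * (max (r - |z|) 0) ^ j := by
    rw [hZ.rootPoleSum_eq, Finset.mul_sum, ← Finset.sum_add_distrib]
    refine Finset.sum_congr rfl fun j _ => ?_
    rw [Finset.mul_sum, ← Finset.sum_add_distrib]
    refine Finset.sum_congr rfl fun z _ => ?_
    have : |omega j f z| = omega j f z + 2 * max (-omega j f z) 0 := by
      rcases le_total 0 (omega j f z) with h0 | h0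
      · rw [abs_of_nonneg h0, max_eq_right (by linarith)]; ring
      · rw [abs_of_nonpos h0, max_eq_left (by linarith)]; ring
    rw [this]
    ring
  rw [characteristic, proximity, hc, hV]
  linarith [le_max_left (f r) 0, le_max_left (f (-r)) 0, le_max_right (f r) 0,
    le_max_right (f (-r)) 0]

theorem abs_sub_initial_le (h : Presents n f x p) (hr : 0 ≤ r) :
    |f r - (f 0 + ∑ j ∈ Finset.Icc 1 n, rightDeriv j f 0 / j.factorial * r ^ j)| ≤
      rootPoleSum n f r := by
  obtain ⟨Z, hZ⟩ := h.exists_covers r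
  rw [h.eq_sum_of_covers hr le_rfl hZ, add_sub_cancel_left, hZ.rootPoleSum_eq,
    Finset.sum_comm (s := Finset.Icc 1 n)]
  calc _ ≤ ∑ z ∈ Z.filter (0 < ·), ∑ j ∈ Finset.Icc 1 n, |omega j f z| * (max (r - |z|) 0) ^ j := by
        refine (Finset.abs_sum_le_sum_abs _ _).trans (Finset.sum_le_sum fun z hz => ?_)
        refine (Finset.abs_sum_le_sum_abs _ _).trans (Finset.sum_le_sum fun j _ => ?_)
        rw [abs_mul, abs_of_pos (Finset.mem_filter.1 hz).2,
          abs_of_nonneg (pow_nonneg (le_max_right (r - z) 0) j)]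
    _ ≤ _ := Finset.sum_le_sum_of_subset_of_nonneg (Finset.filter_subset _ _) fun z _ _ =>
        Finset.sum_nonneg fun j _ => mul_nonneg (abs_nonneg _) (pow_nonneg (le_max_right _ _) _)

end Presents

/-! ### Difference estimates -/

/-- The mean value bound has the factor `m^(j-1)`; enlarging the radius by `d` restores the missing
power, since `m^(j-1) * d ≤ (m + d)^j`. -/
theorem abs_pow_sub_pow_mul_le {j : ℕ} (hj : j ∈ Finset.Icc 1 n) {u v m d : ℝ} (hu : 0 ≤ u)
    (hv : 0 ≤ v) (hum : u ≤ m) (hvm : v ≤ m) (hd : 0 ≤ d) :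
    |u ^ j - v ^ j| * d ≤ |u - v| * n * (m + d) ^ j := by
  obtain ⟨hj1, hjn⟩ := Finset.mem_Icc.1 hj
  have hm : 0 ≤ m := hu.trans hum
  have h1 : |u ^ j - v ^ j| ≤ |u - v| * j * m ^ (j - 1) := by
    refine (abs_pow_sub_pow_le u v j).trans ?_
    gcongr
    rw [abs_of_nonneg hu, abs_of_nonneg hv]
    exact max_le hum hvm
  calc |u ^ j - v ^ j| * d ≤ |u - v| * j * m ^ (j - 1) * d := by gcongr
    _ ≤ |u - v| * n * (m + d) ^ (j - 1) * (m + d) := by gcongr <;> linarith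
    _ = |u - v| * n * (m + d) ^ j := by
      rw [mul_assoc, ← pow_succ, Nat.sub_add_cancel hj1]

theorem abs_max_pow_sub_mul_le {j : ℕ} (hj : j ∈ Finset.Icc 1 n) {s t m z : ℝ} (hs : s ≤ m)
    (ht : t ≤ m) (hm : m ≤ r) :
    |(max (t - z) 0) ^ j - (max (s - z) 0) ^ j| * (r - m) ≤
      |t - s| * n * (max (r - z) 0) ^ j := by
  rcases le_total m z with h | h
  · rw [max_eq_right (by linarith : t - z ≤ 0), max_eq_right (by linarith : s - z ≤ 0), sub_self,
      abs_zero, zero_mul]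
    exact mul_nonneg (by positivity) (pow_nonneg (le_max_right _ _) _)
  · have h1 := abs_pow_sub_pow_mul_le hj (le_max_right (t - z) 0) (le_max_right (s - z) 0)
      (max_le (by linarith) (by linarith) : max (t - z) 0 ≤ m - z)
      (max_le (by linarith) (by linarith) : max (s - z) 0 ≤ m - z) (sub_nonneg.2 hm)
    rw [max_eq_left (by linarith : 0 ≤ r - z)]
    rw [show m - z + (r - m) = r - z by ring] at h1
    refine h1.trans ?_
    have := abs_max_sub_max_le_abs (t - z) (s - z) 0
    rw [sub_sub_sub_cancel_right] at this
    have h2 : 0 ≤ r - z := by linarith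
    gcongr

namespace Presents

/-- Differences of `f` are controlled by the majorant at a larger radius. -/
theorem abs_sub_mul_le (h : Presents n f x p) {s t m : ℝ} (hs0 : 0 ≤ s) (ht0 : 0 ≤ t) (hs : s ≤ m)
    (ht : t ≤ m) (hm : m ≤ r) (hr : 1 ≤ r) :
    |f t - f s| * (r - m) ≤ n * (∑ j ∈ Finset.Icc 1 n, |rightDeriv j f 0 / j.factorial| + 1) *
      |t - s| * majorant n f r := by
  obtain ⟨Z, hZ⟩ := h.exists_covers r
  set a : ℕ → ℝ := fun j => rightDeriv j f 0 / j.factorial with ha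
  have hd : f t - f s = ∑ j ∈ Finset.Icc 1 n, a j * (t ^ j - s ^ j) +
      ∑ z ∈ Z.filter (0 < ·), ∑ j ∈ Finset.Icc 1 n,
        omega j f z * ((max (t - z) 0) ^ j - (max (s - z) 0) ^ j) := by
    rw [h.eq_sum_of_covers ht0 (ht.trans hm) hZ, h.eq_sum_of_covers hs0 (hs.trans hm) hZ]
    simp only [mul_sub, Finset.sum_sub_distrib, ha]
    ring
  have hrm : 0 ≤ r - m := by linarith
  have h1 : |∑ j ∈ Finset.Icc 1 n, a j * (t ^ j - s ^ j)| * (r - m) ≤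
      n * (∑ j ∈ Finset.Icc 1 n, |a j|) * |t - s| * r ^ n := by
    calc _ ≤ (∑ j ∈ Finset.Icc 1 n, |a j * (t ^ j - s ^ j)|) * (r - m) := by
          gcongr; exact Finset.abs_sum_le_sum_abs _ _
      _ ≤ ∑ j ∈ Finset.Icc 1 n, n * |a j| * |t - s| * r ^ n := by
          rw [Finset.sum_mul]
          refine Finset.sum_le_sum fun j hj => ?_
          have := abs_pow_sub_pow_mul_le hj ht0 hs0 ht hs hrm
          rw [add_sub_cancel] at this
          rw [abs_mul, mul_assoc]
          calc |a j| * (|t ^ j - s ^ j| * (r - m)) ≤ |a j| * (|t - s| * n * r ^ j) := by gcongr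
            _ ≤ |a j| * (|t - s| * n * r ^ n) := by
                gcongr
                exact (Finset.mem_Icc.1 hj).2
            _ = _ := by ring
      _ = _ := by simp only [Finset.mul_sum, Finset.sum_mul]
  have h2 : |∑ z ∈ Z.filter (0 < ·), ∑ j ∈ Finset.Icc 1 n,
        omega j f z * ((max (t - z) 0) ^ j - (max (s - z) 0) ^ j)| * (r - m) ≤
      n * |t - s| * rootPoleSum n f r := by
    have hnn : ∀ z j, 0 ≤ |omega j f z| * (max (r - |z|) 0) ^ j := fun z j =>
      mul_nonneg (abs_nonneg _) (pow_nonneg (le_max_right _ _) _)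
    calc _ ≤ (∑ z ∈ Z.filter (0 < ·), ∑ j ∈ Finset.Icc 1 n,
        |omega j f z * ((max (t - z) 0) ^ j - (max (s - z) 0) ^ j)|) * (r - m) := by
          gcongr
          exact (Finset.abs_sum_le_sum_abs _ _).trans
            (Finset.sum_le_sum fun z _ => Finset.abs_sum_le_sum_abs _ _)
      _ ≤ ∑ z ∈ Z.filter (0 < ·), ∑ j ∈ Finset.Icc 1 n,
          n * |t - s| * (|omega j f z| * (max (r - |z|) 0) ^ j) := by
          simp only [Finset.sum_mul]
          refine Finset.sum_le_sum fun z hz => Finset.sum_le_sum fun j hj => ?_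
          have := abs_max_pow_sub_mul_le (z := z) hj hs ht hm
          rw [abs_of_pos (Finset.mem_filter.1 hz).2, abs_mul, mul_assoc]
          calc _ ≤ |omega j f z| * (|t - s| * n * (max (r - z) 0) ^ j) := by gcongr
            _ = _ := by ring
      _ ≤ ∑ z ∈ Z, ∑ j ∈ Finset.Icc 1 n,
          n * |t - s| * (|omega j f z| * (max (r - |z|) 0) ^ j) :=
          Finset.sum_le_sum_of_subset_of_nonneg (Finset.filter_subset _ _) fun z _ _ =>
            Finset.sum_nonneg fun j _ => mul_nonneg (by positivity) (hnn z j)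
      _ = _ := by
          rw [hZ.rootPoleSum_eq, Finset.sum_comm]
          simp only [Finset.mul_sum]
  have hA : 0 ≤ ∑ j ∈ Finset.Icc 1 n, |a j| := Finset.sum_nonneg fun _ _ => abs_nonneg _
  have hV := rootPoleSum_nonneg n f r
  rw [hd, majorant, max_eq_left (by linarith : 0 ≤ r)]
  refine (mul_le_mul_of_nonneg_right (abs_add_le _ _) hrm).trans ?_
  rw [add_mul]
  refine (add_le_add h1 h2).trans ?_
  have hx : 0 ≤ (n : ℝ) * |t - s| := by positivity
  have hrn : 0 ≤ r ^ n := by positivity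
  have e : n * (∑ j ∈ Finset.Icc 1 n, |a j| + 1) * |t - s| * (rootPoleSum n f r + r ^ n + 1) -
      (n * (∑ j ∈ Finset.Icc 1 n, |a j|) * |t - s| * r ^ n + n * |t - s| * rootPoleSum n f r) =
      (n * |t - s|) * ((∑ j ∈ Finset.Icc 1 n, |a j|) * (rootPoleSum n f r + 1) + r ^ n + 1) := by
    ring
  have : 0 ≤ (n * |t - s|) *
      ((∑ j ∈ Finset.Icc 1 n, |a j|) * (rootPoleSum n f r + 1) + r ^ n + 1) := by positivity
  linarith

end Presents

/-! ### Lower growth of the characteristic -/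

theorem characteristic_nonneg (n : ℕ) (f : ℝ → ℝ) (r : ℝ) : 0 ≤ characteristic n f r :=
  add_nonneg (div_nonneg (add_nonneg (le_max_right _ _) (le_max_right _ _)) (by norm_num))
    (Finset.sum_nonneg fun j _ => counting_nonneg j f r)

namespace Presents

theorem leading_term_le (h : Presents n f x p) (hn : 1 ≤ n) (hr : 1 ≤ r) :
    rightDeriv n f 0 / n.factorial * r ^ n -
      (∑ j ∈ Finset.Icc 1 n, |rightDeriv j f 0 / j.factorial|) * r ^ (n - 1) ≤
      f r - f 0 + rootPoleSum n f r := by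
  have h1 := (abs_le.1 (h.abs_sub_initial_le (by linarith : 0 ≤ r))).1
  set a : ℕ → ℝ := fun j => rightDeriv j f 0 / j.factorial
  have hmem : n ∈ Finset.Icc 1 n := Finset.mem_Icc.2 ⟨hn, le_rfl⟩
  have h2 : a n * r ^ n - (∑ j ∈ Finset.Icc 1 n, |a j|) * r ^ (n - 1) ≤
      ∑ j ∈ Finset.Icc 1 n, a j * r ^ j := by
    rw [← Finset.add_sum_erase _ _ hmem, ← Finset.add_sum_erase _ (fun j => a j * r ^ j) hmem,
      add_mul, Finset.sum_mul]
    have h3 : -∑ j ∈ (Finset.Icc 1 n).erase n, |a j| * r ^ (n - 1) ≤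
        ∑ j ∈ (Finset.Icc 1 n).erase n, a j * r ^ j := by
      rw [← Finset.sum_neg_distrib]
      refine Finset.sum_le_sum fun j hj => ?_
      obtain ⟨hj1, hj2⟩ := Finset.mem_erase.1 hj
      have h4 : r ^ j ≤ r ^ (n - 1) :=
        pow_le_pow_right₀ hr (by have := Finset.mem_Icc.1 hj2; omega)
      have h5 : |a j| * r ^ j ≤ |a j| * r ^ (n - 1) := by gcongr
      have h6 : -|a j| * r ^ j ≤ a j * r ^ j := by gcongr; exact neg_abs_le _
      linarith
    have h7 : 0 ≤ |a n| * r ^ (n - 1) := by positivity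
    linarith
  linarith

/-- An `n`-th root or pole alone makes `V(r)` of order `r^n`. Without one, the degree `n`
coefficients on the two sides are opposite and non-zero, so either `f r` or `f (-r)` has a positive
leading term, up to an error `V(r)`. The factor `6` adds `f ≤ 2 T` to `V ≤ 4 T - 2 f 0`. -/
theorem exists_lower_bound (h : Presents n f x p) (hn : 1 ≤ n) : ∃ K D : ℝ, 0 < K ∧ 0 ≤ D ∧
    ∀ᶠ r in atTop, K * r ^ n - D * r ^ (n - 1) ≤ 6 * characteristic n f r := by
  by_cases hω : ∃ z, omega n f z ≠ 0
  · obtain ⟨z, hz⟩ := hω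
    refine ⟨|omega n f z| / 2 ^ n, 2 * |f 0|, by positivity, by positivity, ?_⟩
    filter_upwards [eventually_ge_atTop 1, eventually_gt_atTop (2 * |z|)] with r hr1 hrz
    obtain ⟨Z, hZ⟩ := h.exists_covers r
    have hmem : n ∈ Finset.Icc 1 n := Finset.mem_Icc.2 ⟨hn, le_rfl⟩
    have hzr : |z| < r := by linarith [abs_nonneg z]
    have hnn : ∀ z j, 0 ≤ |omega j f z| * (max (r - |z|) 0) ^ j := fun z j =>
      mul_nonneg (abs_nonneg _) (pow_nonneg (le_max_right _ _) _)
    have h1 : |omega n f z| * (max (r - |z|) 0) ^ n ≤ rootPoleSum n f r := by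
      rw [hZ.rootPoleSum_eq]
      refine le_trans ?_ (Finset.single_le_sum
        (fun j _ => Finset.sum_nonneg fun z _ => hnn z j) hmem)
      exact Finset.single_le_sum (f := fun z => |omega n f z| * (max (r - |z|) 0) ^ n)
        (fun z _ => hnn z n) (hZ.mem n hmem z hzr hz)
    have h2 : (r / 2) ^ n ≤ (max (r - |z|) 0) ^ n := by
      have : 0 ≤ r / 2 := by linarith
      gcongr
      exact le_max_of_le_left (by linarith)
    have h3 : |omega n f z| / 2 ^ n * r ^ n ≤ |omega n f z| * (max (r - |z|) 0) ^ n := by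
      calc |omega n f z| / 2 ^ n * r ^ n = |omega n f z| * (r / 2) ^ n := by
            rw [div_pow]; ring
        _ ≤ _ := by gcongr
    have h4 : 2 * |f 0| * 1 ≤ 2 * |f 0| * r ^ (n - 1) := by
      gcongr; exact one_le_pow₀ hr1
    linarith [h.rootPoleSum_le (by linarith : 0 ≤ r), neg_abs_le (f 0),
      characteristic_nonneg n f r]
  · push Not at hω
    have hab := omega_zero f n
    rw [hω] at hab
    set a : ℝ := rightDeriv n f 0 / n.factorial with ha
    set b : ℝ := rightDeriv n (fun t => f (-t)) 0 / n.factorial with hb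
    have hfac : (n.factorial : ℝ) ≠ 0 := by positivity
    -- If `a = 0` then `b = 0` too, and every segment, reflected if it ends at or before the origin,
    -- would have degree below `n`.
    have ha0 : a ≠ 0 := by
      intro ha0
      have hb0 : b = 0 := by linarith
      obtain ⟨i, hi⟩ := h.exists_coeff_ne_zero hn
      rcases lt_or_ge 0 (x i) with h0 | h0
      · exact hi (h.coeff_eq_zero_of_pos (fun z _ => hω z)
          ((div_eq_zero_iff.1 ha0).resolve_right hfac) h0)
      · have h1 : x (i - 1) < 0 := (h.strictMono (by omega)).trans_le h0
        have h2 := h.comp_neg.coeff_eq_zero_of_pos (i := 1 - i)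
          (fun z _ => by rw [omega_comp_neg]; exact hω _)
          ((div_eq_zero_iff.1 hb0).resolve_right hfac) (by
            rw [neg_sub]; linarith)
        simp only [sub_sub_cancel] at h2
        rw [show (-X : ℝ[X]) = C (-1) * X by simp, comp_C_mul_X_coeff] at h2
        exact hi ((mul_eq_zero.1 h2).resolve_right (by simp))
    rcases lt_or_gt_of_ne ha0 with ha0 | ha0
    · refine ⟨b, (∑ j ∈ Finset.Icc 1 n, |rightDeriv j (fun t => f (-t)) 0 / j.factorial|) +
        3 * |f 0|, by linarith,
        add_nonneg (Finset.sum_nonneg fun _ _ => abs_nonneg _) (by positivity), ?_⟩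
      filter_upwards [eventually_ge_atTop 1] with r hr1
      have h1 := h.comp_neg.leading_term_le hn hr1
      rw [rootPoleSum_comp_neg, neg_zero] at h1
      have h4 : 3 * |f 0| * 1 ≤ 3 * |f 0| * r ^ (n - 1) := by
        gcongr; exact one_le_pow₀ hr1
      linarith [h.rootPoleSum_le (by linarith : 0 ≤ r), neg_abs_le (f 0),
        (le_two_mul_characteristic n f r).2]
    · refine ⟨a, (∑ j ∈ Finset.Icc 1 n, |rightDeriv j f 0 / j.factorial|) +
        3 * |f 0|, ha0,
        add_nonneg (Finset.sum_nonneg fun _ _ => abs_nonneg _) (by positivity), ?_⟩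
      filter_upwards [eventually_ge_atTop 1] with r hr1
      have h1 := h.leading_term_le hn hr1
      have h4 : 3 * |f 0| * 1 ≤ 3 * |f 0| * r ^ (n - 1) := by
        gcongr; exact one_le_pow₀ hr1
      linarith [h.rootPoleSum_le (by linarith : 0 ≤ r), neg_abs_le (f 0),
        (le_two_mul_characteristic n f r).1]

/-- The characteristic grows at least like `r ^ n`. -/
theorem exists_mul_pow_le_characteristic (h : Presents n f x p) (hn : 1 ≤ n) :
    ∃ k : ℝ, 0 < k ∧ ∀ᶠ r in atTop, k * r ^ n ≤ characteristic n f r := by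
  obtain ⟨K, D, hK, hD, hev⟩ := h.exists_lower_bound hn
  refine ⟨K / 12, by positivity, ?_⟩
  filter_upwards [hev, eventually_ge_atTop (2 * D / K), eventually_ge_atTop 0] with r h1 h2 h0
  rw [div_le_iff₀ hK] at h2
  have h3 : 2 * D * r ^ (n - 1) ≤ r * K * r ^ (n - 1) := by gcongr
  have h4 : r ^ n = r * r ^ (n - 1) := by rw [← pow_succ', Nat.sub_add_cancel hn]
  have h5 : K * r ^ n = r * K * r ^ (n - 1) := by rw [h4]; ring
  linarith

theorem tendsto_characteristic (h : Presents n f x p) (hn : 1 ≤ n) :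
    Tendsto (characteristic n f) atTop atTop := by
  obtain ⟨k, hk, hev⟩ := h.exists_mul_pow_le_characteristic hn
  exact tendsto_atTop_mono' _ hev ((tendsto_pow_atTop (by omega)).const_mul_atTop hk)

theorem exists_majorant_le (h : Presents n f x p) (hn : 1 ≤ n) :
    ∃ C : ℝ, 0 < C ∧ ∀ᶠ r in atTop, majorant n f r ≤ C * characteristic n f r := by
  obtain ⟨k, hk, hev⟩ := h.exists_mul_pow_le_characteristic hn
  refine ⟨5 + 1 / k, by positivity, ?_⟩
  filter_upwards [hev, (h.tendsto_characteristic hn).eventually_ge_atTop (2 * |f 0| + 1),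
    eventually_ge_atTop 0] with r h1 h2 h0
  have h3 : r ^ n ≤ 1 / k * characteristic n f r := by
    rw [one_div, ← div_eq_inv_mul, le_div_iff₀ hk]; linarith
  rw [majorant, max_eq_left h0]
  linarith [h.rootPoleSum_le h0, neg_abs_le (f 0)]

/-! ### Hyper-order and the shift estimate -/

theorem hyperOrder_nonneg (h : Presents n f x p) (hn : 1 ≤ n) : 0 ≤ hyperOrder n f := by
  refine le_limsup_of_frequently_le' (Eventually.frequently ?_)
  filter_upwards [(h.tendsto_characteristic hn).eventually_ge_atTop (Real.exp 1),
    eventually_ge_atTop 1] with r h1 h2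
  have h3 : 1 ≤ Real.log (characteristic n f r) := by
    rw [Real.le_log_iff_exp_le ((Real.exp_pos _).trans_le h1)]
    exact h1
  exact_mod_cast div_nonneg (Real.log_nonneg h3) (Real.log_nonneg h2)

theorem characteristic_le_exp (h : Presents n f x p) (hn : 1 ≤ n) {μ : ℝ}
    (hμ : hyperOrder n f < μ) :
    ∀ᶠ r in atTop, characteristic n f r ≤ Real.exp (r ^ μ) := by
  have hlt := eventually_lt_of_limsup_lt hμ
  filter_upwards [hlt, (h.tendsto_characteristic hn).eventually_ge_atTop (Real.exp 1),
    eventually_gt_atTop 1] with r h0 h1 h2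
  have hT : 0 < characteristic n f r := (Real.exp_pos _).trans_le h1
  have h3 : 1 ≤ Real.log (characteristic n f r) := by
    rw [Real.le_log_iff_exp_le hT]
    exact h1
  have h4 : Real.log (Real.log (characteristic n f r)) / Real.log r < μ := by exact_mod_cast h0
  rw [div_lt_iff₀ (Real.log_pos h2), ← Real.log_rpow (by linarith)] at h4
  have h5 := (Real.log_lt_log_iff (by linarith) (Real.rpow_pos_of_pos (by linarith) μ)).1 h4
  exact ((Real.log_lt_iff_lt_exp hT).1 h5).le

/-- The constant in `W ≤ C T` is eventually at most `exp (r^μ)`, and `2 r^μ ≤ r^ν` absorbs the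
product. -/
theorem majorant_le_exp (h : Presents n f x p) (hn : 1 ≤ n) {μ ν : ℝ}
    (hμ : hyperOrder n f < μ) (hν : μ < ν) :
    ∀ᶠ r in atTop, majorant n f r ≤ Real.exp (r ^ ν) := by
  obtain ⟨C, hC, hev⟩ := h.exists_majorant_le hn
  filter_upwards [hev, h.characteristic_le_exp hn hμ,
    (h.tendsto_characteristic hn).eventually_ge_atTop C, eventually_gt_atTop 0,
    (tendsto_rpow_atTop (sub_pos.2 hν)).eventually_ge_atTop 2] with r h1 h2 h3 h0 h4
  have h5 : r ^ ν = r ^ μ * r ^ (ν - μ) := by rw [← Real.rpow_add h0]; congr 1; ring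
  have h6 : r ^ μ + r ^ μ ≤ r ^ ν := by
    rw [h5]; nlinarith [Real.rpow_pos_of_pos h0 μ]
  calc majorant n f r ≤ C * characteristic n f r := h1
    _ ≤ Real.exp (r ^ μ) * Real.exp (r ^ μ) := by
        have := characteristic_nonneg n f r
        gcongr
        exact h3.trans h2
    _ ≤ Real.exp (r ^ ν) := by rw [← Real.exp_add]; exact Real.exp_le_exp.2 h6

theorem exists_abs_shift_sub_le (h : Presents n f x p) {s : ℝ} (hs : 0 < s) (c : ℝ) :
    ∃ C : ℝ, 0 ≤ C ∧ ∀ᶠ r in atTop, |f (r + c) - f r| * r ^ s ≤ C * majorant n f (r + r ^ s) := by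
  refine ⟨2 * (n * (∑ j ∈ Finset.Icc 1 n, |rightDeriv j f 0 / j.factorial| + 1) * |c|), ?_, ?_⟩
  · have := Finset.sum_nonneg fun j (_ : j ∈ Finset.Icc 1 n) =>
      abs_nonneg (rightDeriv j f 0 / j.factorial)
    positivity
  filter_upwards [eventually_ge_atTop 1, eventually_ge_atTop |c|,
    (tendsto_rpow_atTop hs).eventually_ge_atTop (2 * |c|)] with r h1 h2 h3
  have hc1 := neg_abs_le c
  have hc2 := le_abs_self c
  -- Both points lie below `r + |c|`, which leaves a gap `r^s - |c| ≥ r^s / 2`; hence the factor `2`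
  -- in the constant.
  have := h.abs_sub_mul_le (s := r) (t := r + c) (m := r + |c|) (r := r + r ^ s) (by linarith)
    (by linarith) (by linarith) (by linarith) (by linarith [abs_nonneg c])
    (by linarith [abs_nonneg c])
  rw [add_sub_cancel_left] at this
  have h4 : |f (r + c) - f r| * (r ^ s / 2) ≤
      |f (r + c) - f r| * (r + r ^ s - (r + |c|)) := by
    gcongr; linarith
  linarith

end Presents

/-! ### Conclusion -/

theorem isLittleO_of_mul_rpow_le {l : Filter ℝ} (hl : l ≤ atTop) {d T : ℝ → ℝ} {C s σ : ℝ}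
    (hs : σ < s) (hT : ∀ r, 0 ≤ T r) (hd : ∀ r, 0 ≤ d r)
    (h : ∀ᶠ r in l, d r * r ^ s ≤ C * T r) : d =o[l] fun r => T r / r ^ σ := by
  rw [Asymptotics.isLittleO_iff]
  intro ε hε
  filter_upwards [h, hl (eventually_gt_atTop 0),
    hl ((tendsto_rpow_atTop (sub_pos.2 hs)).eventually_ge_atTop (C / ε))] with r h1 h0 h2
  have hσ : 0 < r ^ σ := Real.rpow_pos_of_pos h0 σ
  have h3 : r ^ s = r ^ (s - σ) * r ^ σ := by rw [← Real.rpow_add h0]; congr 1; ring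
  rw [Real.norm_of_nonneg (hd r), Real.norm_of_nonneg (div_nonneg (hT r) hσ.le), ← mul_div_assoc,
    le_div_iff₀ hσ]
  rw [div_le_iff₀ hε] at h2
  have hp : 0 < r ^ (s - σ) := Real.rpow_pos_of_pos h0 _
  have h4 : C * T r ≤ r ^ (s - σ) * ε * T r := mul_le_mul_of_nonneg_right h2 (hT r)
  refine le_of_mul_le_mul_left ?_ hp
  calc r ^ (s - σ) * (d r * r ^ σ) = d r * r ^ s := by rw [h3]; ring
    _ ≤ r ^ (s - σ) * ε * T r := h1.trans h4
    _ = _ := by ring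

end NTropical

theorem theorem4p6 (n : ℕ) (hn : 1 ≤ n) (c : ℝ) (hc : c ≠ 0) (f : ℝ → ℝ)
    (hf : NTropical.IsWellDefined n f) (hρ : NTropical.hyperOrder n f < 1)
    (σ : ℝ) (hσ_pos : 0 < σ) (hσ : (σ : EReal) < 1 - NTropical.hyperOrder n f) :
    ∃ E : Set ℝ, NTropical.FiniteLogMeasure E ∧
      ∀ δ : ℝ, (δ = 1 ∨ δ = -1) →
        Asymptotics.IsLittleO (Filter.atTop ⊓ Filter.principal Eᶜ)
          (fun r : ℝ => |f (δ * r + c) - f (δ * r)|)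
          (fun r : ℝ => NTropical.characteristic n f r / r ^ σ) := by
  obtain ⟨x, p, h, -⟩ := hf
  obtain ⟨ρ, hρeq⟩ : ∃ ρ : ℝ, NTropical.hyperOrder n f = ρ :=
    ⟨(NTropical.hyperOrder n f).toReal, (EReal.coe_toReal (ne_top_of_lt hρ)
      (ne_bot_of_le_ne_bot EReal.zero_ne_bot (h.hyperOrder_nonneg hn))).symm⟩
  have hρ0 : 0 ≤ ρ := by
    have := h.hyperOrder_nonneg hn
    rw [hρeq] at this
    exact_mod_cast this
  have hσ1 : σ < 1 - ρ := by
    rw [hρeq] at hσ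
    exact_mod_cast hσ
  -- With `s = σ + e` and growth exponent `ρ + 2e`, the sum of exponents is `1 - e < 1`; the surplus
  -- `e` in `s` turns `O` into `o`.
  obtain ⟨e, he0, he⟩ : ∃ e : ℝ, 0 < e ∧ 4 * e = 1 - ρ - σ := ⟨(1 - ρ - σ) / 4, by linarith, by ring⟩
  have hexp := h.majorant_le_exp hn (μ := ρ + e) (ν := ρ + 2 * e)
    (by rw [hρeq]; exact_mod_cast (by linarith : ρ < ρ + e)) (by linarith)
  obtain ⟨E, hE, hgrow⟩ := NTropical.exists_finiteLogMeasure_le_two_mul h.majorant_mono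
    (NTropical.one_le_majorant n f) (s := σ + e) (by linarith) (by linarith) (by linarith) hexp
  obtain ⟨C, hC, hmaj⟩ := h.exists_majorant_le hn
  have key : ∀ d : ℝ → ℝ, (∃ A : ℝ, 0 ≤ A ∧ ∀ᶠ r in Filter.atTop,
      |d r| * r ^ (σ + e) ≤ A * NTropical.majorant n f (r + r ^ (σ + e))) →
      Asymptotics.IsLittleO (Filter.atTop ⊓ Filter.principal Eᶜ) (fun r => |d r|)
        (fun r => NTropical.characteristic n f r / r ^ σ) := by
    rintro d ⟨A, hA, hd⟩
    refine NTropical.isLittleO_of_mul_rpow_le inf_le_left (s := σ + e) (C := A * (2 * C))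
      (by linarith) (NTropical.characteristic_nonneg n f) (fun r => abs_nonneg _) ?_
    rw [Filter.eventually_inf_principal]
    filter_upwards [hd, hgrow, hmaj] with r h1 h2 h3 hr
    calc |d r| * r ^ (σ + e) ≤ A * NTropical.majorant n f (r + r ^ (σ + e)) := h1
      _ ≤ A * (2 * (C * NTropical.characteristic n f r)) := by
          gcongr
          exact (h2 hr).trans (by linarith)
      _ = _ := by ring
  refine ⟨E, hE, ?_⟩
  rintro δ (rfl | rfl)
  · refine key _ ?_
    simpa only [one_mul] using h.exists_abs_shift_sub_le (s := σ + e) (by linarith) c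
  · refine key _ ?_
    -- For `g t = f (-t)`, `f (-r + c) = g (r - c)`: the shift becomes `-c`.
    have := h.comp_neg.exists_abs_shift_sub_le (s := σ + e) (by linarith) (-c)
    simpa only [NTropical.majorant_comp_neg, neg_add, neg_neg, neg_one_mul] using this
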